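/- Let $\mathcal H\neq\{0\}$ be a complex Hilbert space (inner product linear in the first variable), and let $\Phi(z)=\sum_{n\ge 0}a_nz^n$ be an entire function on $\mathbb C$ with $a_n\ge 0$ for all $n\ge 0$ and $a_n>0$ for some $n\ge 1$. Let $\Phi(\mathcal H)$ be the reproducing kernel Hilbert space of complex functions on $\mathcal H$ with kernel $K(\xi,\eta)=\Phi(\langle\xi,\eta\rangle)$. For a bounded operator $A$ on $\mathcal H$ let $C_A$ be the (in general unbounded) composition operator in $\Phi(\mathcal H)$ given by $\mathcal D(C_A)=\{f\in\Phi(\mathcal H): f\circ A\in\Phi(\mathcal H)\}$ and $C_Af=f\circ A$ for $f\in\mathcal D(C_A)$. Let $\mathfrak G_\Phi=\{z\in\mathbb C: z^k=1\text{ for every }k\ge 1\text{ with }a_k>0\}$. A densely defined operator $T$ is called positive, written $T\ge 0$, if $\langle Tf,f\rangle\ge 0$ for all $f\in\mathcal D(T)$; it is called selfadjoint if $T=T^*$. The product $ST$ of two operators has domain $\{f\in\mathcal D(T): Tf\in\mathcal D(S)\}$, and equality of operators includes equality of their domains. **Theorem.** For every bounded operator $A$ on $\mathcal H$ (defined on all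 of $\mathcal H$) the following conditions are equivalent: (i) $C_A\ge 0$ (that is, $C_A$ is densely defined and positive); (ii) there exists $\alpha\in\mathfrak G_\Phi$ such that $\alpha A\ge 0$; (iii) there exists a bounded operator $B$ on $\mathcal H$ such that $B\ge 0$ and $C_A=C_B$. Moreover, if $A\ge 0$, then $C_A$ is selfadjoint and $C_A=C_{A^{1/2}}^*\,C_{A^{1/2}}$, where $A^{1/2}$ is the positive square root of $A$. -/

import Mathlib

open scoped ComplexOrder InnerProductSpace

/-- A nonconstant entire function `Φ(z) = ∑ aₙ zⁿ` on `ℂ` with nonnegative Taylor coefficients: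
`aₙ ≥ 0` for all `n ≥ 0`, and `aₙ > 0` for at least one `n ≥ 1`. It is recorded by its
(uniquely determined) sequence of coefficients, whose power series converges everywhere on `ℂ`. -/
structure EntireSymbol where
  /-- The Taylor coefficients at the origin. -/
  coeff : ℕ → ℝ
  coeff_nonneg : ∀ n, 0 ≤ coeff n
  exists_coeff_pos : ∃ n, 1 ≤ n ∧ 0 < coeff n
  summable_coeff : ∀ z : ℂ, Summable fun n : ℕ => (coeff n : ℂ) * z ^ n

namespace EntireSymbol

/-- The entire function `Φ(z) = ∑ aₙ zⁿ`. -/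
noncomputable def toFun (Φ : EntireSymbol) (z : ℂ) : ℂ := ∑' n : ℕ, (Φ.coeff n : ℂ) * z ^ n

/-- The group `𝔊_Φ` of all `z ∈ ℂ` such that `zᵏ = 1` for every `k ≥ 1` with `aₖ > 0`. -/
def rootGroup (Φ : EntireSymbol) : Set ℂ :=
  {z : ℂ | ∀ k : ℕ, 1 ≤ k → 0 < Φ.coeff k → z ^ k = 1}

/-- The kernel `K(ξ, η) = Φ(⟨ξ, η⟩)` on `H`, where `⟨·, ·⟩` is linear in the first variable
(so `⟨ξ, η⟩ = ⟪η, ξ⟫_ℂ`). The scalar `K(ξ, η)` is regarded as an operator on `ℂ`. -/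
noncomputable def kernelMatrix (Φ : EntireSymbol) (H : Type*) [NormedAddCommGroup H]
    [InnerProductSpace ℂ H] : Matrix H H (ℂ →L[ℂ] ℂ) :=
  Matrix.of fun ξ η => Φ.toFun ⟪η, ξ⟫_ℂ • ContinuousLinearMap.id ℂ ℂ

theorem conj_toFun (Φ : EntireSymbol) (z : ℂ) :
    starRingEnd ℂ (Φ.toFun z) = Φ.toFun (starRingEnd ℂ z) := by
  simp [toFun, Complex.conj_tsum]

theorem posSemidef_inner {H E : Type*} [NormedAddCommGroup E] [InnerProductSpace ℂ E] (v : H → E) :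
    (Matrix.of fun ξ η : H => ⟪v ξ, v η⟫_ℂ).PosSemidef := by
  refine ⟨Matrix.ext fun _ _ => inner_conj_symm _ _, fun x => ?_⟩
  have h : (x.sum fun i xi => x.sum fun j xj =>
      star xi * (Matrix.of fun ξ η : H => ⟪v ξ, v η⟫_ℂ) i j * xj)
      = ⟪x.sum fun i xi => xi • v i, x.sum fun i xi => xi • v i⟫_ℂ := by
    simp only [Finsupp.sum, sum_inner, inner_sum, inner_smul_left, inner_smul_right,
      Matrix.of_apply]
    rw [Finset.sum_comm]
    refine Finset.sum_congr rfl fun i _ => ?_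
    rw [Finset.mul_sum]
    refine Finset.sum_congr rfl fun j _ => ?_
    simp only [starRingEnd_apply]
    ring
  rw [h, inner_self_eq_norm_sq_to_K]
  positivity

variable {H : Type*} [NormedAddCommGroup H] [InnerProductSpace ℂ H]

theorem posSemidef_inner_pow (n : ℕ) :
    (Matrix.of fun ξ η : H => ⟪ξ, η⟫_ℂ ^ n).PosSemidef := by
  induction n with
  | zero =>
    have h := posSemidef_inner (H := H) (fun _ => (1 : ℂ))
    simpa using h
  | succ n ih =>
    have h := ih.hadamard (posSemidef_inner (H := H) id)
    have e : (Matrix.of fun ξ η : H => ⟪ξ, η⟫_ℂ ^ (n + 1))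
        = Matrix.hadamard (Matrix.of fun ξ η : H => ⟪ξ, η⟫_ℂ ^ n)
          (Matrix.of fun ξ η : H => ⟪id ξ, id η⟫_ℂ) := by
      ext ξ η
      simp [pow_succ]
    rw [e]
    exact h

theorem sum_toFun_nonneg (Φ : EntireSymbol) (x : H →₀ ℂ) :
    0 ≤ x.sum fun i xi => x.sum fun j xj => star xi * Φ.toFun ⟪i, j⟫_ℂ * xj := by
  have hs : HasSum (fun n : ℕ => (Φ.coeff n : ℂ) *
      x.sum fun i xi => x.sum fun j xj => star xi * ⟪i, j⟫_ℂ ^ n * xj)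
      (x.sum fun i xi => x.sum fun j xj => star xi * Φ.toFun ⟪i, j⟫_ℂ * xj) := by
    simp only [Finsupp.sum, Finset.mul_sum]
    refine hasSum_sum fun i _ => hasSum_sum fun j _ => ?_
    have h := (((Φ.summable_coeff ⟪i, j⟫_ℂ).hasSum).mul_left (star (x i))).mul_right (x j)
    have e : (fun n : ℕ => (Φ.coeff n : ℂ) * (star (x i) * ⟪i, j⟫_ℂ ^ n * x j))
        = fun n : ℕ => star (x i) * ((Φ.coeff n : ℂ) * ⟪i, j⟫_ℂ ^ n) * x j := by
      ext n
      ring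
    rw [e]
    exact h
  refine hs.nonneg fun n => ?_
  refine mul_nonneg (by exact_mod_cast Φ.coeff_nonneg n) ?_
  exact (posSemidef_inner_pow (H := H) n).2 x

/-- The kernel is positive definite, so it has a reproducing kernel Hilbert space. -/
instance factPosSemidefKernelMatrix (Φ : EntireSymbol) (H : Type*) [NormedAddCommGroup H]
    [InnerProductSpace ℂ H] : Fact (Φ.kernelMatrix H).PosSemidef := by
  refine ⟨?_⟩
  have key := (RKHS.posSemidef_tfae (K := Φ.kernelMatrix H)).out 0 2
  rw [key]
  refine ⟨?_, fun v => ?_⟩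
  · refine Matrix.ext fun ξ η => ContinuousLinearMap.ext_ring ?_
    refine ext_inner_right ℂ fun w => ?_
    rw [Matrix.conjTranspose_apply, ContinuousLinearMap.star_eq_adjoint,
      ContinuousLinearMap.adjoint_inner_left]
    simp [kernelMatrix, conj_toFun, mul_comm]
  · have h := Φ.sum_toFun_nonneg (v.mapRange (starRingEnd ℂ) (map_zero _))
    rw [Finsupp.sum_mapRange_index (by simp)] at h
    have e : (v.sum fun x w => v.sum fun x' w' => ⟪(Φ.kernelMatrix H x' x) w, w'⟫_ℂ)
        = starRingEnd ℂ (v.sum fun i xi =>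
          (v.mapRange (starRingEnd ℂ) (map_zero _)).sum fun j xj =>
            star (starRingEnd ℂ xi) * Φ.toFun ⟪i, j⟫_ℂ * xj) := by
      rw [map_finsuppSum]
      refine Finsupp.sum_congr fun i _ => ?_
      rw [Finsupp.sum_mapRange_index (by simp), map_finsuppSum]
      refine Finsupp.sum_congr fun j _ => ?_
      simp [kernelMatrix, conj_toFun]
      ring
    rw [e, RCLike.conj_re]
    exact (RCLike.nonneg_iff.mp h).1

/-- The reproducing kernel Hilbert space `Φ(H)` of functions `H → ℂ` with reproducing kernel
`K(ξ, η) = Φ(⟨ξ, η⟩)`. An element `f` is evaluated at `ξ : H` by `f ξ`. -/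
abbrev Space (Φ : EntireSymbol) (H : Type*) [NormedAddCommGroup H] [InnerProductSpace ℂ H] :
    Type _ := RKHS.OfKernel (Φ.kernelMatrix H)

/-- The composition operator `C_φ` in `Φ(H)` with symbol `φ : H → H`: its domain consists of those
`f ∈ Φ(H)` for which `f ∘ φ` is (the function of) an element of `Φ(H)`, and `C_φ f = f ∘ φ`. -/
noncomputable def compOp (Φ : EntireSymbol) (φ : H → H) : Φ.Space H →ₗ.[ℂ] Φ.Space H where
  domain :=
    { carrier := {f | ∃ g : Φ.Space H, ∀ ξ : H, g ξ = f (φ ξ)}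
      add_mem' := by
        rintro f₁ f₂ ⟨g₁, h₁⟩ ⟨g₂, h₂⟩
        exact ⟨g₁ + g₂, fun ξ => by simp [h₁, h₂]⟩
      zero_mem' := ⟨0, fun ξ => by simp⟩
      smul_mem' := by
        rintro c f ⟨g, h⟩
        exact ⟨c • g, fun ξ => by simp [h]⟩ }
  toFun :=
    { toFun := fun f => f.2.choose
      map_add' := fun f₁ f₂ => RKHS.ext fun ξ => by
        rw [(f₁ + f₂).2.choose_spec ξ, RKHS.coe_add, Pi.add_apply, f₁.2.choose_spec ξ,
          f₂.2.choose_spec ξ]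
        simp
      map_smul' := fun c f => RKHS.ext fun ξ => by
        rw [(c • f).2.choose_spec ξ, RingHom.id_apply, RKHS.coe_smul, Pi.smul_apply,
          f.2.choose_spec ξ]
        simp }

theorem compOp_apply (Φ : EntireSymbol) (φ : H → H) (f : (Φ.compOp φ).domain) (ξ : H) :
    (Φ.compOp φ f) ξ = (f : Φ.Space H) (φ ξ) :=
  f.2.choose_spec ξ

/-- The elements of `Φ(H)` have the reproducing property: the function `η ↦ Φ(⟨η, ξ⟩)` belongs to
`Φ(H)`, and the inner product with it is evaluation at `ξ`. -/
theorem exists_reproducing (Φ : EntireSymbol) (ξ : H) :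
    ∃ k : Φ.Space H, (∀ η : H, k η = Φ.toFun ⟪ξ, η⟫_ℂ) ∧
      ∀ f : Φ.Space H, ⟪k, f⟫_ℂ = f ξ := by
  refine ⟨RKHS.kerFun (Φ.Space H) ξ 1, fun η => ?_, fun f => ?_⟩
  · rw [RKHS.kerFun_apply, RKHS.OfKernel.kernel_ofKernel]
    simp [kernelMatrix]
  · simp

end EntireSymbol

namespace LinearPMap

variable {E : Type*} [NormedAddCommGroup E] [InnerProductSpace ℂ E]

/-- A (not necessarily bounded) operator is positive if it is densely defined and
`⟨T f, f⟩ ≥ 0` for every `f` in its domain. -/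
def IsPositiveOp (T : E →ₗ.[ℂ] E) : Prop :=
  Dense (T.domain : Set E) ∧ ∀ f : T.domain, 0 ≤ ⟪T f, (f : E)⟫_ℂ

/-- The product `S T` of two operators, with its maximal domain
`{f ∈ D(T) : T f ∈ D(S)}`. -/
def prodOp (S T : E →ₗ.[ℂ] E) : E →ₗ.[ℂ] E where
  domain := (S.domain.comap T.toFun).map T.domain.subtype
  toFun :=
    { toFun := fun f => S ⟨T ⟨f, by
          obtain ⟨g, _, hg⟩ := f.2
          exact hg ▸ g.2⟩, by
          obtain ⟨f, g, hg, rfl⟩ := f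
          exact hg⟩
      map_add' := fun f g => by
        rw [← map_add]
        congr 1
        ext1
        exact T.map_add ⟨f, _⟩ ⟨g, _⟩
      map_smul' := fun c f => by
        rw [RingHom.id_apply, ← map_smul]
        congr 1
        ext1
        exact T.map_smul c ⟨f, _⟩ }

theorem mem_prodOp_domain (S T : E →ₗ.[ℂ] E) (f : E) :
    f ∈ (S.prodOp T).domain ↔ ∃ hf : f ∈ T.domain, T ⟨f, hf⟩ ∈ S.domain := by
  constructor
  · rintro ⟨g, hg, rfl⟩
    exact ⟨g.2, hg⟩
  · rintro ⟨hf, h⟩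
    exact ⟨⟨f, hf⟩, h, rfl⟩

end LinearPMap

/-! `Φ(H)` is the ℓ²-sum of homogeneous parts, the part of degree `k` having kernel `aₖ⟨ξ,η⟩ᵏ`. On
each part `C_A` acts as a bounded operator, `partMap k A.adjoint`, and `partMap k` is multiplicative
and respects adjoints; so `C_A` is a diagonal operator with its maximal domain (`decomp_compOp`).
Hence `C_A* = C_{A*}` (`adjoint_compOp`). If `A = B²` with `B` selfadjoint, then `⟨C_A f, f⟩ = ‖C_B
f‖²` part by part, which gives `D(C_A) ⊆ D(C_B)`, positivity and the factorization.

Conversely, positivity of `C_A` passes to every part. Tested on kernel vectors it says `⟨Aξ,ξ⟩ᵏ ≥ 0`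
whenever `aₖ > 0`. For a single such `k ≥ 1`, `inner_eq_nonneg_mul_of_pow` places the whole
numerical range on one ray; rotating that ray to `[0,∞)` costs a phase in `𝔊_Φ`. Such phases do not
change `C_A`, because every `f ∈ Φ(H)` is invariant under them. -/

section Hilbert

/-! ### Operators determined by Gram matrices -/

variable {X E F : Type*} [NormedAddCommGroup E] [InnerProductSpace ℂ E]
  [NormedAddCommGroup F] [InnerProductSpace ℂ F]

theorem eq_of_inner_span_dense {u : X → E} (hu : Dense (Submodule.span ℂ (Set.range u) : Set E))
    {f g : E} (h : ∀ x, ⟪u x, f⟫_ℂ = ⟪u x, g⟫_ℂ) : f = g := by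
  have h' : innerSL ℂ f = innerSL ℂ g := by
    refine ContinuousLinearMap.ext_on hu ?_
    rintro _ ⟨x, rfl⟩
    simp only [innerSL_apply_apply]
    rw [← inner_conj_symm, h, inner_conj_symm]
  refine ext_inner_right ℂ fun v => ?_
  simpa using congrArg (fun T => T v) h'

theorem inner_linearCombination (u : X → E) (c : X →₀ ℂ) :
    ⟪Finsupp.linearCombination ℂ u c, Finsupp.linearCombination ℂ u c⟫_ℂ =
      c.sum fun i ci => c.sum fun j cj => star ci * ⟪u i, u j⟫_ℂ * cj := by
  simp only [Finsupp.linearCombination_apply, Finsupp.sum_inner, Finsupp.inner_sum]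
  simp only [Finsupp.sum]
  rw [Finset.sum_comm]
  refine Finset.sum_congr rfl fun i _ => Finset.sum_congr rfl fun j _ => ?_
  simp only [inner_smul_left, inner_smul_right, starRingEnd_apply]
  ring

/-- A map between the Gram families of dense span extends to a bounded operator when the Gram
matrices are comparable. -/
theorem exists_clm_of_posSemidef [CompleteSpace F] {u : X → E} {w : X → F} {C : ℝ} (hC : 0 ≤ C)
    (hu : Dense (Submodule.span ℂ (Set.range u) : Set E))
    (h : (Matrix.of fun i j : X => (C : ℂ) * ⟪u i, u j⟫_ℂ - ⟪w i, w j⟫_ℂ).PosSemidef) :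
    ∃ T : E →L[ℂ] F, ∀ x, T (u x) = w x := by
  have hd : DenseRange (Finsupp.linearCombination ℂ u) := by
    rw [DenseRange, ← LinearMap.coe_range, Finsupp.range_linearCombination]
    exact hu
  -- Evaluating the quadratic form at `c` gives `‖∑ cₓ wₓ‖² ≤ C ‖∑ cₓ uₓ‖²`.
  have hn : ∀ c, ‖Finsupp.linearCombination ℂ w c‖ ≤
      √C * ‖Finsupp.linearCombination ℂ u c‖ := by
    intro c
    have h1 := h.2 c
    have h2 : (c.sum fun i xi => c.sum fun j xj => star xi *
        (Matrix.of fun i j : X => (C : ℂ) * ⟪u i, u j⟫_ℂ - ⟪w i, w j⟫_ℂ) i j * xj) =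
        C * ⟪Finsupp.linearCombination ℂ u c, Finsupp.linearCombination ℂ u c⟫_ℂ -
        ⟪Finsupp.linearCombination ℂ w c, Finsupp.linearCombination ℂ w c⟫_ℂ := by
      rw [inner_linearCombination, inner_linearCombination]
      simp only [Finsupp.sum, Matrix.of_apply, Finset.mul_sum, ← Finset.sum_sub_distrib]
      refine Finset.sum_congr rfl fun i _ => Finset.sum_congr rfl fun j _ => ?_
      ring
    rw [h2, inner_self_eq_norm_sq_to_K, inner_self_eq_norm_sq_to_K] at h1
    have h3 : ‖Finsupp.linearCombination ℂ w c‖ ^ 2 ≤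
        C * ‖Finsupp.linearCombination ℂ u c‖ ^ 2 := by
      have : (0 : ℂ) ≤ ((C * ‖Finsupp.linearCombination ℂ u c‖ ^ 2 -
        ‖Finsupp.linearCombination ℂ w c‖ ^ 2 : ℝ) : ℂ) := by
        push_cast
        exact h1
      linarith [Complex.zero_le_real.mp this]
    refine le_of_sq_le_sq ?_ (by positivity)
    rwa [mul_pow, Real.sq_sqrt hC]
  refine ⟨(Finsupp.linearCombination ℂ w).extendOfNorm (Finsupp.linearCombination ℂ u),
    fun x => ?_⟩
  have := LinearMap.extendOfNorm_eq hd ⟨_, hn⟩ (Finsupp.single x 1)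
  simpa [FormalMultilinearSeries.coeff] using this

end Hilbert

/-! ### Positive semidefinite matrices and Schur products -/

/-- A positive semidefinite scalar matrix gives a positive semidefinite operator-valued one. -/
theorem Matrix.PosSemidef.smul_id {X : Type*} {M : Matrix X X ℂ} (hM : M.PosSemidef) :
    (Matrix.of fun x y => M x y • ContinuousLinearMap.id ℂ ℂ).PosSemidef := by
  have key := (RKHS.posSemidef_tfae
    (K := Matrix.of fun x y => M x y • ContinuousLinearMap.id ℂ ℂ)).out 0 2
  rw [key]
  refine ⟨?_, fun v => ?_⟩
  · refine Matrix.ext fun x y => ContinuousLinearMap.ext_ring ?_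
    refine ext_inner_right ℂ fun w => ?_
    have := hM.1.apply x y
    rw [Matrix.conjTranspose_apply, ContinuousLinearMap.star_eq_adjoint,
      ContinuousLinearMap.adjoint_inner_left]
    simp [← this, mul_comm]
  · have h := hM.transpose.2 (v.mapRange (starRingEnd ℂ) (map_zero _))
    rw [Finsupp.sum_mapRange_index (by simp)] at h
    have e : (v.sum fun x w => v.sum fun x' w' =>
        ⟪((Matrix.of fun x y => M x y • ContinuousLinearMap.id ℂ ℂ) x' x) w, w'⟫_ℂ)
        = starRingEnd ℂ (v.sum fun i xi =>
          (v.mapRange (starRingEnd ℂ) (map_zero _)).sum fun j xj =>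
            star (starRingEnd ℂ xi) * M.transpose i j * xj) := by
      rw [map_finsuppSum]
      refine Finsupp.sum_congr fun i _ => ?_
      rw [Finsupp.sum_mapRange_index (by simp), map_finsuppSum]
      refine Finsupp.sum_congr fun j _ => ?_
      simp
      ring
    rw [e, RCLike.conj_re]
    exact (RCLike.nonneg_iff.mp h).1

/-- Schur's product theorem for differences of entrywise powers. -/
theorem Matrix.PosSemidef.pow_sub_pow {X : Type*} {P Q : X → X → ℂ}
    (hQ : (Matrix.of Q).PosSemidef) (hPQ : (Matrix.of fun x y => P x y - Q x y).PosSemidef)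
    (n : ℕ) : (Matrix.of fun x y => P x y ^ n - Q x y ^ n).PosSemidef := by
  have hP : (Matrix.of P).PosSemidef := by
    have := hPQ.add hQ
    convert! this using 1
    ext x y
    simp
  have hQn : ∀ n : ℕ, 1 ≤ n → (Matrix.of fun x y => Q x y ^ n).PosSemidef := by
    intro n hn
    induction n, hn using Nat.le_induction with
    | base => simpa using hQ
    | succ n _ ih =>
      convert! ih.hadamard hQ using 1
  induction n with
  | zero =>
    convert! Matrix.PosSemidef.zero (n := X) (R := ℂ) using 1
    ext x y
    simp
  | succ n ih =>
    rcases Nat.eq_zero_or_pos n with rfl | hn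
    · simpa using hPQ
    -- Telescoping: `Pⁿ⁺¹ - Qⁿ⁺¹ = (Pⁿ - Qⁿ) P + Qⁿ (P - Q)`.
    · convert! (ih.hadamard hP).add ((hQn n hn).hadamard hPQ) using 1
      ext x y
      simp
      ring

/-- The quadratic form is `‖A‖² ‖v‖² - ‖A v‖²` with `v = ∑ cₓ x`. -/
theorem posSemidef_opNorm_sub {H E : Type*} [NormedAddCommGroup H] [InnerProductSpace ℂ H]
    [NormedAddCommGroup E] [InnerProductSpace ℂ E] (A : H →L[ℂ] E) :
    (Matrix.of fun x y : H => ((‖A‖ ^ 2 : ℝ) : ℂ) * ⟪x, y⟫_ℂ - ⟪A x, A y⟫_ℂ).PosSemidef := by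
  refine ⟨Matrix.ext fun x y => ?_, fun c => ?_⟩
  · simp
  · have h2 : (c.sum fun i xi => c.sum fun j xj => star xi *
        (Matrix.of fun x y : H => ((‖A‖ ^ 2 : ℝ) : ℂ) * ⟪x, y⟫_ℂ - ⟪A x, A y⟫_ℂ) i j * xj) =
        ((‖A‖ ^ 2 : ℝ) : ℂ) * ⟪Finsupp.linearCombination ℂ id c,
          Finsupp.linearCombination ℂ id c⟫_ℂ -
        ⟪Finsupp.linearCombination ℂ A c, Finsupp.linearCombination ℂ A c⟫_ℂ := by
      rw [inner_linearCombination, inner_linearCombination]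
      simp only [Finsupp.sum, Matrix.of_apply, Finset.mul_sum, ← Finset.sum_sub_distrib, id]
      refine Finset.sum_congr rfl fun i _ => Finset.sum_congr rfl fun j _ => ?_
      ring
    have h3 : Finsupp.linearCombination ℂ A c = A (Finsupp.linearCombination ℂ id c) := by
      simp [Finsupp.linearCombination_apply, map_finsuppSum]
    rw [h2, h3, inner_self_eq_norm_sq_to_K, inner_self_eq_norm_sq_to_K]
    have h4 := A.le_opNorm (Finsupp.linearCombination ℂ id c)
    have h5 : ‖A (Finsupp.linearCombination ℂ id c)‖ ^ 2 ≤
        ‖A‖ ^ 2 * ‖Finsupp.linearCombination ℂ id c‖ ^ 2 := by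
      rw [← mul_pow]
      gcongr
    have : (0 : ℂ) ≤ ((‖A‖ ^ 2 * ‖Finsupp.linearCombination ℂ id c‖ ^ 2 -
        ‖A (Finsupp.linearCombination ℂ id c)‖ ^ 2 : ℝ) : ℂ) :=
      Complex.zero_le_real.mpr (by linarith)
    push_cast at this ⊢
    exact this

theorem eq_zero_of_hasSum_pow {c : ℕ → ℂ} (h : ∀ z : ℂ, HasSum (fun k => z ^ k * c k) 0) :
    c = 0 := by
  have h1 : HasFPowerSeriesAt (fun _ : ℂ => (0 : ℂ))
      (FormalMultilinearSeries.ofScalars ℂ c) 0 :=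
    hasFPowerSeriesAt_iff.mpr (Filter.Eventually.of_forall fun z => by simpa using h z)
  ext n
  have : (FormalMultilinearSeries.ofScalars ℂ c).coeff n = 0 := by
    rw [h1.eq_zero]
    rfl
  simpa using this

/-! ### Decomposition of `Φ(H)` into homogeneous parts -/

namespace EntireSymbol

variable {H : Type*} [NormedAddCommGroup H] [InnerProductSpace ℂ H]

/-- The kernel function `η ↦ Φ(⟨η, ξ⟩)` as an element of `Φ(H)`. -/
noncomputable def kernelVec (Φ : EntireSymbol) (ξ : H) : Φ.Space H :=
  RKHS.kerFun (Φ.Space H) ξ 1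

theorem kernelVec_apply (Φ : EntireSymbol) (ξ η : H) :
    Φ.kernelVec ξ η = Φ.toFun ⟪ξ, η⟫_ℂ := by
  rw [kernelVec, RKHS.kerFun_apply, RKHS.OfKernel.kernel_ofKernel]
  simp [kernelMatrix]

theorem inner_kernelVec (Φ : EntireSymbol) (ξ : H) (f : Φ.Space H) :
    ⟪Φ.kernelVec ξ, f⟫_ℂ = f ξ := by
  simp [kernelVec]

theorem inner_kernelVec_kernelVec (Φ : EntireSymbol) (ξ η : H) :
    ⟪Φ.kernelVec ξ, Φ.kernelVec η⟫_ℂ = Φ.toFun ⟪η, ξ⟫_ℂ := by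
  rw [inner_kernelVec, kernelVec_apply]

theorem _root_.RKHS.dense_span_kerFun_one {X F : Type*} [NormedAddCommGroup F]
    [InnerProductSpace ℂ F] [CompleteSpace F] [RKHS ℂ F X ℂ] :
    Dense (Submodule.span ℂ (Set.range fun x : X => RKHS.kerFun F x (1 : ℂ)) : Set F) := by
  rw [Submodule.dense_iff_topologicalClosure_eq_top, eq_top_iff, ← RKHS.kerFun_dense F]
  refine Submodule.topologicalClosure_mono (Submodule.span_le.mpr ?_)
  rintro _ ⟨x, v, rfl⟩
  have : RKHS.kerFun F x v = v • RKHS.kerFun F x (1 : ℂ) := by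
    rw [← map_smul, smul_eq_mul, mul_one]
  rw [this]
  exact Submodule.smul_mem _ _ (Submodule.subset_span ⟨x, rfl⟩)

theorem dense_span_kernelVec (Φ : EntireSymbol) :
    Dense (Submodule.span ℂ (Set.range (Φ.kernelVec (H := H))) : Set (Φ.Space H)) :=
  RKHS.dense_span_kerFun_one

/-- The kernel `aₖ ⟨ξ, η⟩ᵏ`. -/
noncomputable def partKernel (Φ : EntireSymbol) (H : Type*) [NormedAddCommGroup H]
    [InnerProductSpace ℂ H] (k : ℕ) : Matrix H H (ℂ →L[ℂ] ℂ) :=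
  Matrix.of fun ξ η => ((Φ.coeff k : ℂ) * ⟪η, ξ⟫_ℂ ^ k) • ContinuousLinearMap.id ℂ ℂ

instance factPosSemidefPartKernel (Φ : EntireSymbol) (k : ℕ) :
    Fact (Φ.partKernel H k).PosSemidef := by
  refine ⟨?_⟩
  have h := ((posSemidef_inner_pow (H := H) k).transpose.smul
    (Complex.zero_le_real.mpr (Φ.coeff_nonneg k))).smul_id
  convert! h using 1

/-- The Hilbert space of homogeneous functions of degree `k` with kernel `aₖ ⟨ξ, η⟩ᵏ`. -/
abbrev Part (Φ : EntireSymbol) (H : Type*) [NormedAddCommGroup H] [InnerProductSpace ℂ H]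
    (k : ℕ) : Type _ := RKHS.OfKernel (Φ.partKernel H k)

/-- The kernel functions of the homogeneous parts. -/
noncomputable def partVec (Φ : EntireSymbol) (k : ℕ) (ξ : H) : Φ.Part H k :=
  RKHS.kerFun (Φ.Part H k) ξ 1

theorem inner_partVec_partVec (Φ : EntireSymbol) (k : ℕ) (ξ η : H) :
    ⟪Φ.partVec k ξ, Φ.partVec k η⟫_ℂ = Φ.coeff k * ⟪η, ξ⟫_ℂ ^ k := by
  rw [partVec, RKHS.kerFun_inner, partVec, RKHS.kerFun_apply, RKHS.OfKernel.kernel_ofKernel]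
  simp [partKernel]

theorem dense_span_partVec (Φ : EntireSymbol) (k : ℕ) :
    Dense (Submodule.span ℂ (Set.range (Φ.partVec (H := H) k)) : Set (Φ.Part H k)) :=
  RKHS.dense_span_kerFun_one

/-- Kernel vectors depend antilinearly on the point, hence the conjugate. This homogeneity is what
separates the degrees in `part_unique`. -/
theorem partVec_smul (Φ : EntireSymbol) (k : ℕ) (z : ℂ) (ξ : H) :
    Φ.partVec k (z • ξ) = (starRingEnd ℂ z) ^ k • Φ.partVec k ξ := by
  refine eq_of_inner_span_dense (Φ.dense_span_partVec k) fun η => ?_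
  simp only [inner_smul_right, inner_partVec_partVec, inner_smul_left, mul_pow]
  ring

theorem norm_partVec_sq (Φ : EntireSymbol) (k : ℕ) (ξ : H) :
    ‖Φ.partVec k ξ‖ ^ 2 = Φ.coeff k * (‖ξ‖ ^ 2) ^ k := by
  have h := Φ.inner_partVec_partVec k ξ ξ
  rw [inner_self_eq_norm_sq_to_K, inner_self_eq_norm_sq_to_K] at h
  have h' : ((‖Φ.partVec k ξ‖ ^ 2 : ℝ) : ℂ) = ((Φ.coeff k * (‖ξ‖ ^ 2) ^ k : ℝ) : ℂ) := by
    push_cast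
    exact h
  exact_mod_cast h'

/-- Schur's theorem gives the bound `‖A‖ᵏ`. It need not be uniform in `k`, so `C_A` itself may be
unbounded. -/
theorem exists_partMap (Φ : EntireSymbol) (k : ℕ) (A : H →L[ℂ] H) :
    ∃ T : Φ.Part H k →L[ℂ] Φ.Part H k, ∀ ξ, T (Φ.partVec k ξ) = Φ.partVec k (A ξ) := by
  refine exists_clm_of_posSemidef (C := (‖A‖ ^ 2) ^ k) (by positivity)
    (Φ.dense_span_partVec k) ?_
  have hQ : (Matrix.of fun x y : H => ⟪A x, A y⟫_ℂ).PosSemidef := posSemidef_inner A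
  have h := ((hQ.pow_sub_pow (posSemidef_opNorm_sub A) k).transpose.smul
    (Complex.zero_le_real.mpr (Φ.coeff_nonneg k)))
  convert! h using 1
  ext ξ η
  simp only [inner_partVec_partVec, Matrix.of_apply, Matrix.smul_apply, Matrix.transpose_apply,
    smul_eq_mul, mul_pow]
  push_cast
  ring

/-- The bounded operator on the homogeneous part of degree `k` sending the kernel function at `ξ`
to the kernel function at `A ξ`. -/
noncomputable def partMap (Φ : EntireSymbol) (k : ℕ) (A : H →L[ℂ] H) :
    Φ.Part H k →L[ℂ] Φ.Part H k := (Φ.exists_partMap k A).choose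

theorem partMap_partVec (Φ : EntireSymbol) (k : ℕ) (A : H →L[ℂ] H) (ξ : H) :
    Φ.partMap k A (Φ.partVec k ξ) = Φ.partVec k (A ξ) := (Φ.exists_partMap k A).choose_spec ξ

theorem partMap_comp (Φ : EntireSymbol) (k : ℕ) (A B : H →L[ℂ] H) (f : Φ.Part H k) :
    Φ.partMap k (A ∘L B) f = Φ.partMap k A (Φ.partMap k B f) := by
  have : Φ.partMap k (A ∘L B) = Φ.partMap k A ∘L Φ.partMap k B := by
    refine ContinuousLinearMap.ext_on (Φ.dense_span_partVec k) ?_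
    rintro _ ⟨x, rfl⟩
    simp [partMap_partVec]
  rw [this, ContinuousLinearMap.comp_apply]

theorem partMap_inner [CompleteSpace H] (Φ : EntireSymbol) (k : ℕ) (A : H →L[ℂ] H)
    (f g : Φ.Part H k) :
    ⟪Φ.partMap k A f, g⟫_ℂ = ⟪f, Φ.partMap k A.adjoint g⟫_ℂ := by
  have : Φ.partMap k A.adjoint = (Φ.partMap k A).adjoint := by
    refine ContinuousLinearMap.ext_on (Φ.dense_span_partVec k) ?_
    rintro _ ⟨x, rfl⟩
    refine eq_of_inner_span_dense (Φ.dense_span_partVec k) fun y => ?_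
    rw [ContinuousLinearMap.adjoint_inner_right, partMap_partVec, partMap_partVec,
      inner_partVec_partVec, inner_partVec_partVec, ContinuousLinearMap.adjoint_inner_left]
  rw [this, ContinuousLinearMap.adjoint_inner_right]

theorem memℓp_partVec (Φ : EntireSymbol) (ξ : H) :
    Memℓp (fun k => Φ.partVec k ξ) 2 := by
  refine memℓp_gen ?_
  have h := Φ.summable_coeff ((‖ξ‖ ^ 2 : ℝ) : ℂ)
  have h' : Summable fun k => Φ.coeff k * (‖ξ‖ ^ 2) ^ k := by
    exact_mod_cast h
  refine h'.congr fun k => ?_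
  rw [← norm_partVec_sq]
  simp

/-- Both Gram matrices equal `∑ aₖ⟨ξ,η⟩ᵏ`, so the comparison holds with `C = 1` and difference zero.
-/
theorem exists_decomp (Φ : EntireSymbol) :
    ∃ V : Φ.Space H →L[ℂ] lp (fun k => Φ.Part H k) 2,
      ∀ ξ, V (Φ.kernelVec ξ) = ⟨fun k => Φ.partVec k ξ, Φ.memℓp_partVec ξ⟩ := by
  refine exists_clm_of_posSemidef (C := 1) zero_le_one Φ.dense_span_kernelVec ?_
  convert! Matrix.PosSemidef.zero (n := H) (R := ℂ) using 1
  ext ξ η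
  simp [lp.inner_eq_tsum, inner_partVec_partVec, inner_kernelVec_kernelVec, toFun]

/-- The decomposition of `Φ(H)` into homogeneous parts. -/
noncomputable def decomp (Φ : EntireSymbol) :
    Φ.Space H →L[ℂ] lp (fun k => Φ.Part H k) 2 := Φ.exists_decomp.choose

theorem decomp_kernelVec (Φ : EntireSymbol) (ξ : H) (k : ℕ) :
    Φ.decomp (Φ.kernelVec ξ) k = Φ.partVec k ξ := by
  rw [decomp, Φ.exists_decomp.choose_spec]

theorem inner_decomp (Φ : EntireSymbol) (f g : Φ.Space H) :
    ⟪Φ.decomp f, Φ.decomp g⟫_ℂ = ⟪f, g⟫_ℂ := by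
  have : Φ.decomp.adjoint ∘L Φ.decomp = ContinuousLinearMap.id ℂ (Φ.Space H) := by
    refine ContinuousLinearMap.ext_on Φ.dense_span_kernelVec ?_
    rintro _ ⟨x, rfl⟩
    refine eq_of_inner_span_dense Φ.dense_span_kernelVec fun y => ?_
    rw [ContinuousLinearMap.comp_apply, ContinuousLinearMap.adjoint_inner_right]
    simp [lp.inner_eq_tsum, inner_partVec_partVec, inner_kernelVec_kernelVec, toFun,
      decomp_kernelVec]
  rw [← ContinuousLinearMap.adjoint_inner_right, ← ContinuousLinearMap.comp_apply, this]
  rfl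

theorem hasSum_inner_decomp (Φ : EntireSymbol) (f g : Φ.Space H) :
    HasSum (fun k => ⟪Φ.decomp f k, Φ.decomp g k⟫_ℂ) ⟪f, g⟫_ℂ := by
  rw [← inner_decomp]
  exact lp.hasSum_inner _ _

theorem hasSum_decomp (Φ : EntireSymbol) (f : Φ.Space H) (ξ : H) :
    HasSum (fun k => ⟪Φ.partVec k ξ, Φ.decomp f k⟫_ℂ) (f ξ) := by
  have := Φ.hasSum_inner_decomp (Φ.kernelVec ξ) f
  simpa only [decomp_kernelVec, inner_kernelVec] using this

theorem hasSum_adjoint_decomp (Φ : EntireSymbol) (h : lp (fun k => Φ.Part H k) 2) (ξ : H) :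
    HasSum (fun k => ⟪Φ.partVec k ξ, h k⟫_ℂ) (Φ.decomp.adjoint h ξ) := by
  have := lp.hasSum_inner (𝕜 := ℂ) (Φ.decomp (Φ.kernelVec ξ)) h
  rw [← ContinuousLinearMap.adjoint_inner_right, inner_kernelVec] at this
  simpa only [decomp_kernelVec] using this

/-- A function has at most one expansion into homogeneous parts. -/
theorem part_unique (Φ : EntireSymbol) {F : H → ℂ} {h h' : ∀ k, Φ.Part H k}
    (hh : ∀ ξ, HasSum (fun k => ⟪Φ.partVec k ξ, h k⟫_ℂ) (F ξ))
    (hh' : ∀ ξ, HasSum (fun k => ⟪Φ.partVec k ξ, h' k⟫_ℂ) (F ξ)) (k : ℕ) : h k = h' k := by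
  refine eq_of_inner_span_dense (Φ.dense_span_partVec k) fun ξ => ?_
  -- Replacing `ξ` by `z • ξ` turns the difference of the two expansions into a power series in `z`
  -- with sum zero.
  have := eq_zero_of_hasSum_pow (c := fun k => ⟪Φ.partVec k ξ, h k⟫_ℂ - ⟪Φ.partVec k ξ, h' k⟫_ℂ)
    fun z => by
      have := (hh (z • ξ)).sub (hh' (z • ξ))
      simpa only [partVec_smul, inner_smul_left, map_pow, Complex.conj_conj, sub_self,
        ← mul_sub] using this
  exact sub_eq_zero.mp (congrFun this k)

/-- Surjectivity of the isometry `decomp`: every square-summable family of parts comes from an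
element of `Φ(H)`. -/
theorem decomp_adjoint_decomp (Φ : EntireSymbol) (h : lp (fun k => Φ.Part H k) 2) (k : ℕ) :
    Φ.decomp (Φ.decomp.adjoint h) k = h k :=
  Φ.part_unique (Φ.hasSum_decomp _) (Φ.hasSum_adjoint_decomp h) k

/-! ### Composition operators as diagonal operators -/

variable [CompleteSpace H]

/-- This needs no domain condition: `f ∘ A` always has a pointwise homogeneous expansion, so
membership in `D(C_A)` is only a matter of square-summability. -/
theorem hasSum_partMap_adjoint (Φ : EntireSymbol) (A : H →L[ℂ] H) (f : Φ.Space H) (ξ : H) :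
    HasSum (fun k => ⟪Φ.partVec k ξ, Φ.partMap k A.adjoint (Φ.decomp f k)⟫_ℂ) (f (A ξ)) := by
  simpa only [← partMap_inner, partMap_partVec] using Φ.hasSum_decomp f (A ξ)

theorem decomp_compOp (Φ : EntireSymbol) (A : H →L[ℂ] H) (f : (Φ.compOp A).domain) (k : ℕ) :
    Φ.decomp (Φ.compOp A f) k = Φ.partMap k A.adjoint (Φ.decomp (f : Φ.Space H) k) := by
  refine Φ.part_unique (F := fun ξ => (f : Φ.Space H) (A ξ)) (fun ξ => ?_)
    (Φ.hasSum_partMap_adjoint A f) k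
  rw [← compOp_apply]
  exact Φ.hasSum_decomp _ ξ

theorem inner_compOp (Φ : EntireSymbol) (A : H →L[ℂ] H) (f : (Φ.compOp A).domain)
    (g : (Φ.compOp A.adjoint).domain) :
    ⟪Φ.compOp A f, (g : Φ.Space H)⟫_ℂ = ⟪(f : Φ.Space H), Φ.compOp A.adjoint g⟫_ℂ := by
  refine HasSum.unique (Φ.hasSum_inner_decomp _ _) ?_
  convert! Φ.hasSum_inner_decomp (f : Φ.Space H) (Φ.compOp A.adjoint g) using 2 with k
  rw [decomp_compOp, decomp_compOp, partMap_inner]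

theorem kernelVec_comp (Φ : EntireSymbol) (A : H →L[ℂ] H) (ξ η : H) :
    Φ.kernelVec (A.adjoint ξ) η = Φ.kernelVec ξ (A η) := by
  rw [kernelVec_apply, kernelVec_apply, ContinuousLinearMap.adjoint_inner_left]

theorem kernelVec_mem_domain (Φ : EntireSymbol) (A : H →L[ℂ] H) (ξ : H) :
    Φ.kernelVec ξ ∈ (Φ.compOp A).domain :=
  ⟨Φ.kernelVec (A.adjoint ξ), Φ.kernelVec_comp A ξ⟩

theorem dense_domain_compOp (Φ : EntireSymbol) (A : H →L[ℂ] H) :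
    Dense ((Φ.compOp A).domain : Set (Φ.Space H)) := by
  refine Φ.dense_span_kernelVec.mono (Submodule.span_le.mpr ?_)
  rintro _ ⟨ξ, rfl⟩
  exact Φ.kernelVec_mem_domain A ξ

theorem compOp_kernelVec (Φ : EntireSymbol) (A : H →L[ℂ] H) (ξ : H) :
    Φ.compOp A ⟨Φ.kernelVec ξ, Φ.kernelVec_mem_domain A ξ⟩ = Φ.kernelVec (A.adjoint ξ) :=
  RKHS.ext fun η => by rw [compOp_apply, kernelVec_comp]

theorem adjoint_compOp (Φ : EntireSymbol) (A : H →L[ℂ] H) :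
    (Φ.compOp A).adjoint = Φ.compOp A.adjoint := by
  have hd := Φ.dense_domain_compOp A
  have hle : Φ.compOp A.adjoint ≤ (Φ.compOp A).adjoint :=
    LinearPMap.IsFormalAdjoint.le_adjoint hd fun g f => Φ.inner_compOp A g f
  refine (LinearPMap.eq_of_le_of_domain_eq hle (le_antisymm hle.1 fun f hf => ?_)).symm
  -- Pairing with kernel vectors, which `C_A` maps to kernel vectors, shows that the adjoint applied
  -- to `f` is the function `f ∘ A*`.
  refine ⟨(Φ.compOp A).adjoint ⟨f, hf⟩, fun ξ => ?_⟩
  have h := LinearPMap.adjoint_isFormalAdjoint hd ⟨f, hf⟩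
    ⟨Φ.kernelVec ξ, Φ.kernelVec_mem_domain A ξ⟩
  rw [compOp_kernelVec] at h
  rw [← inner_kernelVec, ← inner_kernelVec, ← inner_conj_symm, h, inner_conj_symm]

/-- If `A = B²` with `B` selfadjoint, then `D(C_A) ⊆ D(C_B)`. -/
theorem domain_compOp_le_of_sq (Φ : EntireSymbol) {A B : H →L[ℂ] H} (hB : B.adjoint = B)
    (hAB : B ∘L B = A) : (Φ.compOp A).domain ≤ (Φ.compOp B).domain := by
  intro f hf
  have hA : A.adjoint = A := by
    rw [← hAB, ContinuousLinearMap.adjoint_comp, hB]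
  -- The right-hand sides are summable because `f` and `C_A f` both lie in `Φ(H)`.
  have hn : ∀ k, ‖Φ.partMap k B (Φ.decomp f k)‖ ^ 2 =
      ‖⟪Φ.decomp f k, Φ.decomp (Φ.compOp A ⟨f, hf⟩) k⟫_ℂ‖ := by
    intro k
    have hT : Φ.partMap k A.adjoint (Φ.decomp f k) =
        Φ.partMap k B.adjoint (Φ.partMap k B (Φ.decomp f k)) := by
      rw [hA, hB, ← partMap_comp, hAB]
    rw [decomp_compOp, hT, ← partMap_inner, inner_self_eq_norm_sq_to_K]
    simp
  have hm : Memℓp (fun k => Φ.partMap k B (Φ.decomp f k)) 2 := by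
    refine memℓp_gen ?_
    have := (Φ.hasSum_inner_decomp f (Φ.compOp A ⟨f, hf⟩)).summable.norm
    refine this.congr fun k => ?_
    rw [← hn]
    simp
  refine ⟨Φ.decomp.adjoint ⟨_, hm⟩, fun ξ => (Φ.hasSum_adjoint_decomp ⟨_, hm⟩ ξ).unique ?_⟩
  have := Φ.hasSum_partMap_adjoint B f ξ
  rwa [hB] at this

theorem compOp_eq_prodOp_of_sq (Φ : EntireSymbol) {A B : H →L[ℂ] H} (hB : B.adjoint = B)
    (hAB : B ∘L B = A) : Φ.compOp A = (Φ.compOp B).adjoint.prodOp (Φ.compOp B) := by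
  rw [adjoint_compOp, hB]
  have hA : ∀ ξ, A ξ = B (B ξ) := fun ξ => by rw [← hAB]; rfl
  refine LinearPMap.ext ?_ ?_
  · ext f
    rw [LinearPMap.mem_prodOp_domain]
    constructor
    · intro hf
      refine ⟨Φ.domain_compOp_le_of_sq hB hAB hf, ?_⟩
      obtain ⟨g, hg⟩ := hf
      exact ⟨g, fun ξ => by rw [hg, compOp_apply, hA]⟩
    · rintro ⟨hf, g, hg⟩
      exact ⟨g, fun ξ => by rw [hg, compOp_apply, hA]⟩
  · intro f hf hf'
    refine RKHS.ext fun ξ => ?_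
    rw [compOp_apply, hA]
    refine Eq.trans ?_ (compOp_apply Φ B _ ξ).symm
    rw [compOp_apply]

theorem isPositiveOp_compOp_of_sq (Φ : EntireSymbol) {A B : H →L[ℂ] H} (hB : B.adjoint = B)
    (hAB : B ∘L B = A) : (Φ.compOp A).IsPositiveOp := by
  have hA : ∀ ξ, A ξ = B (B ξ) := fun ξ => by rw [← hAB]; rfl
  refine ⟨Φ.dense_domain_compOp A, fun f => ?_⟩
  have hf := Φ.domain_compOp_le_of_sq hB hAB f.2
  have h1 : (Φ.compOp B ⟨f, hf⟩) ∈ (Φ.compOp B.adjoint).domain :=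
    ⟨Φ.compOp A f, fun ξ => by rw [compOp_apply, compOp_apply, hB, hA]⟩
  have h2 : Φ.compOp B.adjoint ⟨_, h1⟩ = Φ.compOp A f :=
    RKHS.ext fun ξ => by
      rw [compOp_apply, compOp_apply, compOp_apply, hB, hA]
  rw [← h2, ← inner_conj_symm, ← Φ.inner_compOp B ⟨f, hf⟩ ⟨_, h1⟩, inner_conj_symm,
    inner_self_eq_norm_sq_to_K]
  positivity

/-- Positivity of `C_A` passes to the homogeneous parts. -/
theorem partMap_adjoint_nonneg (Φ : EntireSymbol) {A : H →L[ℂ] H}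
    (hA : (Φ.compOp A).IsPositiveOp) (k : ℕ) (w : Φ.Part H k) :
    0 ≤ ⟪Φ.partMap k A.adjoint w, w⟫_ℂ := by
  -- The function whose only homogeneous part is `w`; its image also lives in degree `k` alone, so
  -- it is in the domain.
  set f : Φ.Space H := Φ.decomp.adjoint (lp.single 2 k w) with hf
  have hfd : ∀ j, Φ.decomp f j = lp.single 2 k w j := Φ.decomp_adjoint_decomp _
  have hmem : f ∈ (Φ.compOp A).domain := by
    refine ⟨Φ.decomp.adjoint (lp.single 2 k (Φ.partMap k A.adjoint w)), fun ξ => ?_⟩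
    refine (Φ.hasSum_adjoint_decomp _ ξ).unique ?_
    convert! Φ.hasSum_partMap_adjoint A f ξ using 3 with j
    rw [hfd]
    by_cases hj : j = k
    · subst hj
      simp
    · simp [hj]
  have h := hA.2 ⟨f, hmem⟩
  have hs := Φ.hasSum_inner_decomp (Φ.compOp A ⟨f, hmem⟩) f
  have h1 := hasSum_single (f := fun j => ⟪Φ.decomp (Φ.compOp A ⟨f, hmem⟩) j, Φ.decomp f j⟫_ℂ) k
    fun j hj => by simp [hfd, hj]
  rw [hs.unique h1, decomp_compOp] at h
  simpa [hfd] using h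

end EntireSymbol

/-! ### Powers of the numerical range -/

theorem Complex.nonneg_of_pos_mul {a b : ℂ} (ha : 0 < a) (h : 0 ≤ a * b) : 0 ≤ b := by
  obtain ⟨h1, h2⟩ := Complex.pos_iff.mp ha
  obtain ⟨h3, h4⟩ := Complex.nonneg_iff.mp h
  simp only [Complex.mul_re, Complex.mul_im, ← h2, zero_mul, sub_zero, add_zero] at h3 h4
  refine Complex.nonneg_iff.mpr ⟨nonneg_of_mul_nonneg_right h3 h1, ?_⟩
  exact ((mul_eq_zero.mp h4.symm).resolve_left h1.ne').symm

/-- The imaginary part of the power vanishes on `[0,∞)`, and its one-sided derivative at `0` is `k ·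
Im w`. -/
theorem Complex.im_eq_zero_of_one_add_mul_pow_nonneg {w : ℂ} {k : ℕ} (hk : 1 ≤ k)
    (h : ∀ s : ℝ, 0 ≤ s → 0 ≤ (1 + s * w) ^ k) : w.im = 0 := by
  have h1 : HasDerivAt (fun s : ℝ => (1 + (s : ℂ) * w) ^ k) (k * w) 0 := by
    have := (((Complex.ofRealCLM.hasDerivAt (x := 0)).mul_const w).const_add 1).fun_pow k
    simpa using this
  have h2 : HasDerivWithinAt (fun s : ℝ => ((1 + (s : ℂ) * w) ^ k).im) (k * w).im
      (Set.Ici 0) 0 :=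
    (Complex.imCLM.hasFDerivAt.comp_hasDerivAt (0 : ℝ) h1).hasDerivWithinAt
  have h3 : HasDerivWithinAt (fun s : ℝ => ((1 + (s : ℂ) * w) ^ k).im) 0 (Set.Ici 0) 0 := by
    refine (hasDerivWithinAt_const (0 : ℝ) (Set.Ici 0) (0 : ℝ)).congr (fun s hs => ?_) (by simp)
    exact (Complex.nonneg_iff.mp (h s hs)).2.symm
  have h4 := (uniqueDiffWithinAt_Ici (0 : ℝ)).eq_deriv _ h2 h3
  have hk' : (k : ℝ) ≠ 0 := by positivity
  simpa [hk', show k ≠ 0 by omega] using h4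

section NumericalRange

variable {H : Type*} [NormedAddCommGroup H] [InnerProductSpace ℂ H]

/-- Along `x + t S x` the form is `c t² + 2t‖S x‖²`; it stays nonnegative for small negative `t`
only if the linear term vanishes. -/
theorem ContinuousLinearMap.IsPositive.apply_eq_zero {S : H →L[ℂ] H} (hS : S.IsPositive) {x : H}
    (hx : ⟪S x, x⟫_ℂ = 0) : S x = 0 := by
  have hsym : ∀ y, ⟪S y, x⟫_ℂ = ⟪y, S x⟫_ℂ := fun y => hS.inner_left_eq_inner_right y x
  have key : ∀ t : ℝ, 0 ≤ t ^ 2 * (⟪S (S x), S x⟫_ℂ).re + 2 * t * ‖S x‖ ^ 2 := by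
    intro t
    have h := hS.re_inner_nonneg_left (x + (t : ℂ) • S x)
    have e1 : ⟪S x, S x⟫_ℂ = ((‖S x‖ ^ 2 : ℝ) : ℂ) := by
      rw [inner_self_eq_norm_sq_to_K]
      simp
    have e : ⟪S (x + (t : ℂ) • S x), x + (t : ℂ) • S x⟫_ℂ =
        ((t ^ 2 : ℝ) : ℂ) * ⟪S (S x), S x⟫_ℂ + ((2 * t * ‖S x‖ ^ 2 : ℝ) : ℂ) := by
      simp only [map_add, map_smul, inner_add_left, inner_add_right, inner_smul_left,
        inner_smul_right, hx, hsym, e1, Complex.conj_ofReal]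
      push_cast
      ring
    rw [e, RCLike.re_eq_complex_re, Complex.add_re, Complex.re_ofReal_mul,
      Complex.ofReal_re] at h
    exact h
  have h0 : ‖S x‖ ^ 2 = 0 := by
    set c := (⟪S (S x), S x⟫_ℂ).re
    have hc : 0 ≤ c := hS.re_inner_nonneg_left (S x)
    -- The `+ 1` keeps the denominator positive when `c = 0`; the value becomes `-d²(c + 2)`.
    have h := key (-(‖S x‖ ^ 2 / (c + 1)))
    have hd : ‖S x‖ ^ 2 / (c + 1) * (c + 1) = ‖S x‖ ^ 2 := by field_simp
    set d := ‖S x‖ ^ 2 / (c + 1)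
    have hd0 : 0 ≤ d := by positivity
    rw [← hd] at h ⊢
    have : d * d * (c + 2) ≤ 0 := by nlinarith
    have : d * d ≤ 0 := by nlinarith [mul_nonneg hd0 hd0]
    have : d = 0 := by nlinarith
    rw [this, zero_mul]
  simpa using h0

/-- If `⟨A ξ, η⟩ᵏ` behaves like a positive form, then the numerical range of `A` lies on a ray. -/
theorem inner_eq_nonneg_mul_of_pow {A : H →L[ℂ] H} {k : ℕ} (hk : 1 ≤ k)
    (hpos : ∀ ξ, 0 ≤ ⟪A ξ, ξ⟫_ℂ ^ k) (hsymm : ∀ ξ η, ⟪A ξ, η⟫_ℂ ^ k = ⟪ξ, A η⟫_ℂ ^ k)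
    (hker : ∀ ξ, ⟪A ξ, ξ⟫_ℂ = 0 → A ξ = 0) {ξ : H} (hξ : ⟪A ξ, ξ⟫_ℂ ≠ 0) (η : H) :
    ∃ r : ℝ, 0 ≤ r ∧ ⟪A η, η⟫_ℂ = r * ⟪A ξ, ξ⟫_ℂ := by
  have hk0 : k ≠ 0 := by omega
  set p := ⟪A ξ, ξ⟫_ℂ with hp
  -- Splitting off the component along `ξ` kills the cross terms: one by the choice of `c`, the
  -- other by `hsymm`.
  obtain ⟨c, η', rfl, h1⟩ : ∃ (c : ℂ) (η' : H), η = η' + c • ξ ∧ ⟪A ξ, η'⟫_ℂ = 0 := by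
    refine ⟨⟪A ξ, η⟫_ℂ / p, η - (⟪A ξ, η⟫_ℂ / p) • ξ, by abel, ?_⟩
    rw [inner_sub_right, inner_smul_right, ← hp]
    field_simp
    ring
  have h2 : ⟪A η', ξ⟫_ℂ = 0 := by
    have := hsymm ξ η'
    rw [h1, zero_pow hk0] at this
    rw [← inner_conj_symm, pow_eq_zero_iff hk0 |>.mp this.symm, map_zero]
  set q := ⟪A η', η'⟫_ℂ with hq
  have hform : ∀ t : ℝ, ⟪A (ξ + (t : ℂ) • η'), ξ + (t : ℂ) • η'⟫_ℂ = p + (t ^ 2 : ℝ) * q := by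
    intro t
    simp only [map_add, map_smul, inner_add_left, inner_add_right, inner_smul_left,
      inner_smul_right, h1, h2, ← hp, ← hq, Complex.conj_ofReal]
    push_cast
    ring
  have hpk : 0 < p ^ k := lt_of_le_of_ne (hpos ξ) (pow_ne_zero k hξ).symm
  -- A nonnegative `k`-th power alone allows `k` rays; moving along the path `p + s q` from `p`
  -- forces `q / p` to be real.
  have him : (q / p).im = 0 := by
    refine Complex.im_eq_zero_of_one_add_mul_pow_nonneg hk fun s hs => ?_
    have h := hpos (ξ + ((√s : ℝ) : ℂ) • η')
    rw [hform, Real.sq_sqrt hs] at h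
    have e : p + s * q = p * (1 + s * (q / p)) := by
      field_simp
    rw [e, mul_pow] at h
    exact Complex.nonneg_of_pos_mul hpk h
  have hqp : q = ((q / p).re : ℂ) * p := by
    have : ((q / p).re : ℂ) = q / p := Complex.ext rfl (by simp [him])
    rw [this]
    field_simp
  -- If `q / p` were negative, the form would vanish at some `ξ + t η'`; `hker` then makes `A`
  -- vanish there, and pairing with `ξ` gives `p = 0`.
  have hre : 0 ≤ (q / p).re := by
    by_contra! hneg
    set w := (q / p).re
    have h := hform (√(-1 / w))
    rw [Real.sq_sqrt (div_nonneg_of_nonpos (by norm_num) hneg.le), hqp] at h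
    have e : p + ((-1 / w : ℝ) : ℂ) * (w * p) = 0 := by
      have : (w : ℂ) ≠ 0 := by exact_mod_cast hneg.ne
      push_cast
      field_simp
      ring
    rw [e] at h
    have h' := congrArg (fun v => ⟪v, ξ⟫_ℂ) (hker _ h)
    simp only [map_add, map_smul, inner_add_left, inner_smul_left, h2, inner_zero_left, mul_zero,
      add_zero] at h'
    exact hξ h'
  refine ⟨(q / p).re + ‖c‖ ^ 2, by positivity, ?_⟩
  have hc : starRingEnd ℂ c * c = (‖c‖ : ℂ) ^ 2 := by
    rw [mul_comm, Complex.mul_conj']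
  simp only [map_add, map_smul, inner_add_left, inner_add_right, inner_smul_left,
      inner_smul_right, h1, h2, ← hp, ← hq]
  push_cast
  rw [add_mul, ← hqp, ← hc]
  ring

end NumericalRange

/-! ### Phases in `𝔊_Φ` and square roots -/

namespace EntireSymbol

variable {H : Type*} [NormedAddCommGroup H] [InnerProductSpace ℂ H]

/-- Only degrees with `aₖ = 0` could see the factor `αᵏ`. -/
theorem toFun_mul_of_mem_rootGroup (Φ : EntireSymbol) {α : ℂ} (hα : α ∈ Φ.rootGroup) (z : ℂ) :
    Φ.toFun (α * z) = Φ.toFun z := by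
  refine tsum_congr fun k => ?_
  rcases Nat.eq_zero_or_pos k with rfl | hk
  · simp
  rcases (Φ.coeff_nonneg k).eq_or_lt with h | h
  · simp [← h]
  · rw [mul_pow, hα k hk h, one_mul]

theorem apply_smul_of_mem_rootGroup (Φ : EntireSymbol) {α : ℂ} (hα : α ∈ Φ.rootGroup)
    (f : Φ.Space H) (ξ : H) : f (α • ξ) = f ξ := by
  rw [← inner_kernelVec, ← inner_kernelVec]
  congr 1
  refine RKHS.ext fun η => ?_
  have hα' : starRingEnd ℂ α ∈ Φ.rootGroup := fun k hk h => by
    rw [← map_pow, hα k hk h, map_one]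
  rw [kernelVec_apply, kernelVec_apply, inner_smul_left, toFun_mul_of_mem_rootGroup Φ hα']

theorem compOp_congr (Φ : EntireSymbol) {φ ψ : H → H}
    (h : ∀ (f : Φ.Space H) ξ, f (φ ξ) = f (ψ ξ)) : Φ.compOp φ = Φ.compOp ψ := by
  refine LinearPMap.ext ?_ ?_
  · ext f
    exact exists_congr fun g => forall_congr' fun ξ => by rw [h]
  · intro f hf hf'
    exact RKHS.ext fun ξ => by rw [compOp_apply, compOp_apply, h]

variable [CompleteSpace H]

theorem exists_smul_isPositive (Φ : EntireSymbol) {A : H →L[ℂ] H}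
    (hA : (Φ.compOp A).IsPositiveOp) : ∃ α ∈ Φ.rootGroup, (α • A).IsPositive := by
  have hinner : ∀ k ξ η, ⟪Φ.partMap k A.adjoint (Φ.partVec k ξ), Φ.partVec k η⟫_ℂ =
      Φ.coeff k * ⟪A η, ξ⟫_ℂ ^ k := fun k ξ η => by
    rw [partMap_partVec, inner_partVec_partVec, ContinuousLinearMap.adjoint_inner_right]
  have hpos : ∀ k, 0 < Φ.coeff k → ∀ ξ, 0 ≤ ⟪A ξ, ξ⟫_ℂ ^ k := by
    intro k hk ξ
    have h := Φ.partMap_adjoint_nonneg hA k (Φ.partVec k ξ)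
    rw [hinner] at h
    exact Complex.nonneg_of_pos_mul (Complex.zero_lt_real.mpr hk) h
  obtain ⟨k, hk, hak⟩ := Φ.exists_coeff_pos
  have hk0 : k ≠ 0 := by omega
  have hak' : (Φ.coeff k : ℂ) ≠ 0 := by exact_mod_cast hak.ne'
  have hS : (Φ.partMap k A.adjoint).IsPositive := by
    rw [ContinuousLinearMap.isPositive_iff_complex]
    intro w
    have h := Complex.nonneg_iff.mp (Φ.partMap_adjoint_nonneg hA k w)
    exact ⟨Complex.ext rfl h.2, h.1⟩
  have hsymm : ∀ ξ η, ⟪A ξ, η⟫_ℂ ^ k = ⟪ξ, A η⟫_ℂ ^ k := by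
    intro ξ η
    have h := hS.inner_left_eq_inner_right (Φ.partVec k η) (Φ.partVec k ξ)
    rw [hinner, ← inner_conj_symm (Φ.partVec k η), hinner] at h
    simp only [map_mul, map_pow, inner_conj_symm, Complex.conj_ofReal] at h
    exact mul_left_cancel₀ hak' h
  -- A zero of the form of the positive operator on the degree-`k` part lies in its kernel; testing
  -- on kernel vectors brings this back to `A`.
  have hker : ∀ ξ, ⟪A ξ, ξ⟫_ℂ = 0 → A ξ = 0 := by
    intro ξ hξ
    have h := hS.apply_eq_zero (x := Φ.partVec k ξ) (by rw [hinner, hξ, zero_pow hk0, mul_zero])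
    refine ext_inner_left ℂ fun η => ?_
    have h' := hinner k ξ η
    rw [h, inner_zero_left, hsymm, eq_comm, mul_eq_zero, or_iff_right hak',
      pow_eq_zero_iff hk0] at h'
    rw [h', inner_zero_right]
  by_cases h0 : ∀ ξ, ⟪A ξ, ξ⟫_ℂ = 0
  · have : A = 0 := ContinuousLinearMap.ext fun ξ => hker ξ (h0 ξ)
    exact ⟨1, fun k _ _ => one_pow k, by simp [this]⟩
  · push Not at h0
    obtain ⟨ξ, hξ⟩ := h0
    set p := ⟪A ξ, ξ⟫_ℂ with hp
    have hn : (‖p‖ : ℂ) ≠ 0 := by simpa using hξ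
    -- The inner product is antilinear in its first slot, so the phase of `p` itself, not its
    -- conjugate, rotates the ray to `[0,∞)`. Since `pʲ ≥ 0` whenever `aⱼ > 0`, this phase lies in
    -- `𝔊_Φ`.
    refine ⟨p / ‖p‖, fun j hj haj => ?_, ?_⟩
    · have h := Complex.norm_of_nonneg' (hpos j haj ξ)
      rw [← hp, norm_pow, Complex.ofReal_pow] at h
      rw [div_pow, h, div_self (pow_ne_zero j hξ)]
    · rw [ContinuousLinearMap.isPositive_iff_complex]
      intro η
      obtain ⟨r, hr, h⟩ := inner_eq_nonneg_mul_of_pow hk (hpos k hak) hsymm hker hξ η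
      have e : ⟪((p / ‖p‖ : ℂ) • A) η, η⟫_ℂ = ((r * ‖p‖ : ℝ) : ℂ) := by
        rw [smul_apply, inner_smul_left, h, ← hp, map_div₀,
          Complex.conj_ofReal]
        have := Complex.conj_mul' p
        push_cast
        field_simp
        linear_combination (r : ℂ) * this
      rw [e]
      exact ⟨by simp, by simpa using by positivity⟩

theorem sqrt_adjoint {B : H →L[ℂ] H} :
    (CFC.sqrt B : H →L[ℂ] H).adjoint = CFC.sqrt B := by
  rw [← ContinuousLinearMap.star_eq_adjoint]
  exact (IsSelfAdjoint.of_nonneg (CFC.sqrt_nonneg B)).star_eq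

theorem sqrt_comp_sqrt {B : H →L[ℂ] H} (hB : B.IsPositive) :
    (CFC.sqrt B : H →L[ℂ] H) ∘L CFC.sqrt B = B :=
  CFC.sqrt_mul_sqrt_self B ((ContinuousLinearMap.nonneg_iff_isPositive B).mpr hB)

end EntireSymbol

theorem theorem9p2 {H : Type*} [NormedAddCommGroup H] [InnerProductSpace ℂ H] [CompleteSpace H]
    [Nontrivial H] (Φ : EntireSymbol) (A : H →L[ℂ] H) :
    [(Φ.compOp A).IsPositiveOp,
      ∃ α ∈ Φ.rootGroup, (α • A).IsPositive,
      ∃ B : H →L[ℂ] H, B.IsPositive ∧ Φ.compOp A = Φ.compOp B].TFAE ∧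
    (A.IsPositive →
      IsSelfAdjoint (Φ.compOp A) ∧
      Φ.compOp A = (Φ.compOp ⇑(CFC.sqrt A : H →L[ℂ] H)).adjoint.prodOp (Φ.compOp ⇑(CFC.sqrt A : H →L[ℂ] H))) := by
  refine ⟨?_, fun hA => ⟨?_, ?_⟩⟩
  · tfae_have 1 → 2 := Φ.exists_smul_isPositive
    tfae_have 2 → 3 := fun ⟨α, hα, h⟩ => ⟨α • A, h, Φ.compOp_congr fun f ξ =>
      (Φ.apply_smul_of_mem_rootGroup hα f (A ξ)).symm⟩
    tfae_have 3 → 1 := fun ⟨B, hB, h⟩ => h ▸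
      Φ.isPositiveOp_compOp_of_sq EntireSymbol.sqrt_adjoint (EntireSymbol.sqrt_comp_sqrt hB)
    tfae_finish
  · rw [LinearPMap.isSelfAdjoint_def, EntireSymbol.adjoint_compOp, hA.isSelfAdjoint.adjoint_eq]
  · exact Φ.compOp_eq_prodOp_of_sq EntireSymbol.sqrt_adjoint (EntireSymbol.sqrt_comp_sqrt hA)
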